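/- Let $k$ be a field. Let $R$ be any one of the following rings: - $R=k[x_1,x_2,x_3]/(x_1x_2,\;x_1x_3)$; - $R=k[x_1,x_2]/(x_1^2,\;x_1x_2,\;x_2^2)$; - $R=k[x_1,\ldots,x_n]/(x_1^2,\;x_ix_j : 1\le i,j\le n,\ i\neq j)$, for any integer $n\geq 2$. Then the injective dimension of $R$ as a module over itself is infinite. Moreover, $\operatorname{Ext}^i_R(R/(x_1),R)\neq 0$ for infinitely many integers $i\ge 0$. -/

import Mathlib

open CategoryTheory MvPolynomial

universe u

/-- The injective dimension of a commutative ring `R` as a module over itself. It takes values in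
`WithBot ℕ∞`: `⊥` for the zero ring, and `⊤` if no finite injective resolution exists. -/
noncomputable def selfInjectiveDimension (R : Type u) [CommRing R] : WithBot ℕ∞ :=
  injectiveDimension (ModuleCat.of R R)

/-- `Ext^i_R(R/(a), R) ≠ 0` for infinitely many natural numbers `i`. -/
def InfinitelyManyExtNeZero (R : Type u) [CommRing R] (a : R) : Prop :=
  {i : ℕ | Nontrivial
    (Abelian.Ext.{u} (ModuleCat.of R (R ⧸ Ideal.span {a})) (ModuleCat.of R R) i)}.Infinite

/-- `k[x₁, x₂, x₃] / (x₁ x₂, x₁ x₃)`; the variables are indexed from `0`. -/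
abbrev LinePlaneRing (k : Type u) [Field k] : Type u :=
  MvPolynomial (Fin 3) k ⧸
    (Ideal.span {X 0 * X 1, X 0 * X 2} : Ideal (MvPolynomial (Fin 3) k))

/-- `k[x₁, x₂] / (x₁², x₁ x₂, x₂²)`; the variables are indexed from `0`. -/
abbrev AllQuadraticRing (k : Type u) [Field k] : Type u :=
  MvPolynomial (Fin 2) k ⧸
    (Ideal.span {X 0 ^ 2, X 0 * X 1, X 1 ^ 2} : Ideal (MvPolynomial (Fin 2) k))

/-- The ideal `(x₁², xᵢ xⱼ : i ≠ j)` of `k[x₁, …, xₙ]`, where `n ≥ 1`;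
the variables are indexed from `0`. -/
noncomputable def mixedIdeal (k : Type u) [Field k] (n : ℕ) [NeZero n] : Ideal (MvPolynomial (Fin n) k) :=
  Ideal.span ({X 0 ^ 2} ∪ {p | ∃ i j : Fin n, i ≠ j ∧ p = X i * X j})

/-- `k[x₁, …, xₙ] / (x₁², xᵢ xⱼ : i ≠ j)`. -/
abbrev MixedRing (k : Type u) [Field k] (n : ℕ) [NeZero n] : Type u :=
  MvPolynomial (Fin n) k ⧸ mixedIdeal k n

open Abelian

/-! Finite injective dimension would kill all high Ext groups, so it suffices to find nonzero ones.
This is done by dimension shifting along syzygies that repeat. In the last two families, `x = x₁`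
has the ideal `m` of all variables as annihilator, so `R ⧸ m` is a syzygy of `R ⧸ (x)`; and `R ⧸ m`
is a direct summand of `m`, its own syzygy. Nonvanishing of `Ext¹(R ⧸ m, R)` thus propagates to
every higher degree (`infinitelyManyExtNeZero_of_retraction`). For the line and plane, write `y, z`
for the other variables. The second syzygy of `R ⧸ (x)` is `(y, z)`, whose Koszul resolution over `R
⧸ (x)` returns to `R ⧸ (x)`; each round raises the degree by 3
(`infinitelyManyExtNeZero_of_koszul`). -/

theorem selfInjectiveDimension_eq_top {R : Type u} [CommRing R] {a : R}
    (h : InfinitelyManyExtNeZero R a) : selfInjectiveDimension R = ⊤ := by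
  by_contra hne
  obtain ⟨n, hn⟩ := (injectiveDimension_ne_top_iff _).1 hne
  obtain ⟨i, hi, hni⟩ := h.exists_gt n
  have := HasInjectiveDimensionLT.subsingleton (ModuleCat.of R R) (n + 1) i hni
    (ModuleCat.of R (R ⧸ Ideal.span {a}))
  exact not_nontrivial_iff_subsingleton.2 this hi

/-! ### Dimension shifting for Ext -/

section ExtLemmas

variable {R : Type u} [CommRing R] {S : ShortComplex (ModuleCat.{u} R)}

/-- The connecting map is injective because `Ext^i` out of a projective vanishes for `i ≠ 0`. -/
theorem nontrivial_ext_succ_of_projective (hS : S.ShortExact) [Projective S.X₂]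
    {Y : ModuleCat.{u} R} {i : ℕ} (hi : i ≠ 0) (h : Nontrivial (Ext.{u} S.X₁ Y i)) :
    Nontrivial (Ext.{u} S.X₃ Y (i + 1)) := by
  obtain ⟨e, he⟩ := exists_ne (0 : Ext.{u} S.X₁ Y i)
  refine ⟨hS.extClass.comp e (add_comm 1 i), 0, fun h0 => he ?_⟩
  obtain ⟨i, rfl⟩ := Nat.exists_eq_succ_of_ne_zero hi
  obtain ⟨x₂, rfl⟩ := Ext.contravariant_sequence_exact₁ hS Y e _ h0
  rw [Ext.eq_zero_of_projective x₂, Ext.comp_zero]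

theorem nontrivial_ext_one_of_not_factors (hS : S.ShortExact) {Y : ModuleCat.{u} R}
    (g : S.X₁ ⟶ Y) (h : ∀ t : S.X₂ ⟶ Y, S.f ≫ t ≠ g) :
    Nontrivial (Ext.{u} S.X₃ Y 1) := by
  refine ⟨hS.extClass.comp (Ext.mk₀ g) (add_zero 1), 0, fun h0 => ?_⟩
  obtain ⟨x₂, hx⟩ := Ext.contravariant_sequence_exact₁ hS Y (Ext.mk₀ g) _ h0
  obtain ⟨t, rfl⟩ := (Ext.mk₀_bijective _ _).2 x₂
  rw [Ext.mk₀_comp_mk₀] at hx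
  exact h t ((Ext.mk₀_bijective _ _).1 hx)

theorem nontrivial_ext_of_retract {M N Y : ModuleCat.{u} R} (s : M ⟶ N) (p : N ⟶ M)
    (hsp : s ≫ p = 𝟙 M) {i : ℕ} (h : Nontrivial (Ext.{u} M Y i)) :
    Nontrivial (Ext.{u} N Y i) := by
  obtain ⟨e, he⟩ := exists_ne (0 : Ext.{u} M Y i)
  refine ⟨(Ext.mk₀ p).comp e (zero_add i), 0, fun h0 => he ?_⟩
  have := congrArg (fun t => (Ext.mk₀ s).comp t (zero_add i)) h0
  simpa [Ext.mk₀_comp_mk₀_assoc, hsp] using this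

theorem smul_ext_quotient_eq_zero {J : Ideal R} {a : R} (ha : a ∈ J) {Y : ModuleCat.{u} R}
    {i : ℕ} (e : Ext.{u} (ModuleCat.of R (R ⧸ J)) Y i) : a • e = 0 := by
  have h0 : a • 𝟙 (ModuleCat.of R (R ⧸ J)) = 0 := by
    ext
    simpa [Algebra.smul_def] using! Ideal.Quotient.eq_zero_iff_mem.2 ha
  have : a • e = (Ext.mk₀ (a • 𝟙 (ModuleCat.of R (R ⧸ J)))).comp e (zero_add i) := by
    rw [Ext.mk₀_smul, Ext.smul_comp, Ext.mk₀_id_comp]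
  rw [this, h0, Ext.mk₀_zero, Ext.zero_comp]

/-- `0 → J → R → R ⧸ J → 0`. -/
noncomputable def idealQuotientComplex (J : Ideal R) : ShortComplex (ModuleCat.{u} R) :=
  ShortComplex.moduleCatMk (J.subtype) (J.mkQ) (by
    ext; simp [Ideal.Quotient.eq_zero_iff_mem])

instance (J : Ideal R) : Projective (idealQuotientComplex J).X₂ :=
  inferInstanceAs (Projective (ModuleCat.of R R))

theorem idealQuotientComplex_shortExact (J : Ideal R) :
    (idealQuotientComplex J).ShortExact :=
  ModuleCat.shortComplex_shortExact _ (LinearMap.exact_subtype_mkQ J)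
    J.injective_subtype J.mkQ_surjective

/-- Multiplication by an element `x` annihilated by `J`, as a map `R ⧸ J → R`. -/
abbrev quotientMul {x : R} {J : Ideal R} (h : ∀ r : R, r * x = 0 ↔ r ∈ J) : (R ⧸ J) →ₗ[R] R :=
  Submodule.liftQ J (LinearMap.toSpanSingleton R R x) (fun r hr => by simpa using (h r).2 hr)

/-- `0 → R ⧸ J → R → R ⧸ (x) → 0`, where `J` is the annihilator of `x`. -/
noncomputable def annihilatorComplex {x : R} {J : Ideal R} (h : ∀ r : R, r * x = 0 ↔ r ∈ J) :
    ShortComplex (ModuleCat.{u} R) :=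
  ShortComplex.moduleCatMk (quotientMul h) (Submodule.mkQ (Ideal.span {x})) (by
    ext
    change Ideal.Quotient.mk (Ideal.span {x}) ((1 : R) • x) = 0
    rw [one_smul, Ideal.Quotient.eq_zero_iff_mem]
    exact Ideal.mem_span_singleton_self x)

instance {x : R} {J : Ideal R} (h : ∀ r : R, r * x = 0 ↔ r ∈ J) :
    Projective (annihilatorComplex h).X₂ :=
  inferInstanceAs (Projective (ModuleCat.of R R))

theorem annihilatorComplex_shortExact {x : R} {J : Ideal R} (h : ∀ r : R, r * x = 0 ↔ r ∈ J) :
    (annihilatorComplex h).ShortExact := by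
  refine ModuleCat.shortComplex_shortExact _ ?_ ?_ (Submodule.mkQ_surjective _)
  · refine LinearMap.exact_iff.2 ?_
    change LinearMap.ker (Submodule.mkQ (Ideal.span {x})) = LinearMap.range (quotientMul h)
    rw [Submodule.ker_mkQ, Submodule.range_liftQ, LinearMap.range_toSpanSingleton]
  · change Function.Injective (quotientMul h)
    rw [← LinearMap.ker_eq_bot, Submodule.ker_liftQ_eq_bot]
    intro r hr
    exact (h r).1 (by simpa using hr)

end ExtLemmas

/-! ### Rings in which `R ⧸ m` splits off `m` -/

theorem infinitelyManyExtNeZero_of_retraction {R : Type u} [CommRing R] {x : R} {m : Ideal R}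
    (h : ∀ r : R, r * x = 0 ↔ r ∈ m) (hx : x ∈ m) (p : m →ₗ[R] R ⧸ m) (hp : p ⟨x, hx⟩ = 1)
    (y : m) (hy : p y = 0) (hne : ∀ r : R, r * x = x → r * y ≠ 0) :
    InfinitelyManyExtNeZero R x := by
  have hone : Nontrivial (Ext.{u} (ModuleCat.of R (R ⧸ m)) (ModuleCat.of R R) 1) := by
    refine nontrivial_ext_one_of_not_factors (idealQuotientComplex_shortExact m)
      (ModuleCat.ofHom (quotientMul h ∘ₗ p)) fun t ht => ?_
    let t : ModuleCat.of R R ⟶ ModuleCat.of R R := t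
    have key (j : m) : (j : R) * t.hom 1 = quotientMul h (p j) := by
      have := congrArg (fun f => f.hom j) ht
      have h2 : t.hom (j : R) = quotientMul h (p j) := this
      rw [← h2, ← smul_eq_mul, ← map_smul, smul_eq_mul, mul_one]
    -- An extension to `R` of the map `m → R ⧸ m → R` is multiplication by `t 1`, which would fix
    -- `x` and kill `y`.
    refine hne (t.hom 1) ?_ ?_
    · have := key ⟨x, hx⟩
      rw [hp] at this
      rw [mul_comm]
      refine this.trans ?_
      change (1 : R) • x = x
      rw [one_smul]
    · rw [mul_comm, key y, hy, map_zero]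
  have hmx : ∀ r ∈ m, r • (⟨x, hx⟩ : m) = 0 := fun r hr => Subtype.ext ((h r).2 hr)
  let s : (R ⧸ m) →ₗ[R] m := Submodule.liftQ m (LinearMap.toSpanSingleton R m ⟨x, hx⟩)
    (fun r hr => by simpa using hmx r hr)
  have hsp : ModuleCat.ofHom s ≫ ModuleCat.ofHom p = 𝟙 (ModuleCat.of R (R ⧸ m)) := by
    ext
    change p ((1 : R) • (⟨x, hx⟩ : m)) = 1
    rw [one_smul, hp]
  have hall (i : ℕ) :
      Nontrivial (Ext.{u} (ModuleCat.of R (R ⧸ m)) (ModuleCat.of R R) (i + 1)) := by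
    induction i with
    | zero => exact hone
    | succ i ih =>
      exact nontrivial_ext_succ_of_projective (idealQuotientComplex_shortExact m)
        i.succ_ne_zero (nontrivial_ext_of_retract _ _ hsp ih)
  refine Set.infinite_of_forall_exists_gt fun n => ⟨n + 1 + 1, ?_, by lia⟩
  exact nontrivial_ext_succ_of_projective (annihilatorComplex_shortExact h)
    n.succ_ne_zero (hall n)

/-! ### Period-three syzygies from a Koszul complex -/

section Koszul

variable {R : Type u} [CommRing R] {x y z : R}

theorem mem_span_pair_left (y z : R) : y ∈ Ideal.span {y, z} := Ideal.subset_span (by simp)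

theorem mem_span_pair_right (y z : R) : z ∈ Ideal.span {y, z} := Ideal.subset_span (by simp)

/-- The map `r ↦ r • a` from `R ⧸ (x)` to the ideal `J`, for `a ∈ J` annihilated by `x`. -/
def quotientSpanToIdeal {J : Ideal R} (a : R) (ha : a ∈ J) (hxa : x * a = 0) :
    (R ⧸ Ideal.span {x}) →ₗ[R] J :=
  Submodule.liftQ (Ideal.span {x}) (LinearMap.toSpanSingleton R J ⟨a, ha⟩) (by
    rw [Ideal.span, Submodule.span_singleton_le_iff_mem, LinearMap.mem_ker]
    exact Subtype.ext hxa)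

@[simp]
theorem quotientSpanToIdeal_one {J : Ideal R} (a : R) (ha : a ∈ J) (hxa : x * a = 0) :
    (quotientSpanToIdeal a ha hxa 1 : R) = a :=
  one_smul R a

/-- The complex `0 → R ⧸ (x) → (R ⧸ (x))² → (y, z) → 0` with maps `(z, -y)` and `(y, z)`. -/
noncomputable def koszulComplex (hxy : x * y = 0) (hxz : x * z = 0) :
    ShortComplex (ModuleCat.{u} R) :=
  ShortComplex.moduleCatMk
    (X₁ := R ⧸ Ideal.span {x}) (X₂ := (R ⧸ Ideal.span {x}) × (R ⧸ Ideal.span {x}))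
    (X₃ := (Ideal.span {y, z} : Ideal R))
    (z • LinearMap.inl R _ _ + (-y) • LinearMap.inr R _ _)
    (LinearMap.coprod (quotientSpanToIdeal y (mem_span_pair_left y z) hxy)
      (quotientSpanToIdeal z (mem_span_pair_right y z) hxz)) (by
    ext
    simp [mul_comm])

theorem koszulComplex_shortExact (hxy : x * y = 0) (hxz : x * z = 0)
    (hsyz : ∀ a b : R, a * y + b * z = 0 →
      ∃ c, a - c * z ∈ Ideal.span {x} ∧ b + c * y ∈ Ideal.span {x})
    (hreg : ∀ c : R, c * y ∈ Ideal.span {x} → c ∈ Ideal.span {x}) :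
    (koszulComplex hxy hxz).ShortExact := by
  refine ModuleCat.shortComplex_shortExact _ ?_ ?_ ?_
  · rintro ⟨a, b⟩
    obtain ⟨a, rfl⟩ := Ideal.Quotient.mk_surjective a
    obtain ⟨b, rfl⟩ := Ideal.Quotient.mk_surjective b
    constructor
    · intro hab
      obtain ⟨c, h1, h2⟩ := hsyz a b (congrArg Subtype.val hab)
      refine ⟨Ideal.Quotient.mk _ c, Prod.ext ?_ ?_⟩
      · change z • Ideal.Quotient.mk (Ideal.span {x}) c + (-y) • 0 = Ideal.Quotient.mk _ a
        rw [smul_zero, add_zero]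
        exact (Ideal.Quotient.eq.2 (by rwa [mul_comm] at h1)).symm
      · change z • 0 + (-y) • Ideal.Quotient.mk (Ideal.span {x}) c = Ideal.Quotient.mk _ b
        rw [smul_zero, zero_add]
        exact (Ideal.Quotient.eq.2 (by
          change b - -y * c ∈ _
          rwa [neg_mul, sub_neg_eq_add, mul_comm])).symm
    · rintro ⟨c, hc⟩
      rw [← hc]
      exact (koszulComplex hxy hxz).moduleCat_zero_apply c
  · refine (injective_iff_map_eq_zero (koszulComplex hxy hxz).f.hom).2 fun c hc => ?_
    obtain ⟨c, rfl⟩ := Ideal.Quotient.mk_surjective c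
    have h2 : z • 0 + (-y) • Ideal.Quotient.mk (Ideal.span {x}) c = 0 := congrArg Prod.snd hc
    rw [smul_zero, zero_add] at h2
    have h3 : -y * c ∈ Ideal.span {x} := Ideal.Quotient.eq_zero_iff_mem.1 h2
    rw [neg_mul, neg_mem_iff, mul_comm] at h3
    exact Ideal.Quotient.eq_zero_iff_mem.2 (hreg c h3)
  · rintro ⟨j, hj⟩
    obtain ⟨a, b, rfl⟩ := Ideal.mem_span_pair.1 hj
    exact ⟨(Ideal.Quotient.mk _ a, Ideal.Quotient.mk _ b), rfl⟩

theorem infinitelyManyExtNeZero_of_koszul (hann : ∀ r : R, r * x = 0 ↔ r ∈ Ideal.span {y, z})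
    (hsyz : ∀ a b : R, a * y + b * z = 0 →
      ∃ c, a - c * z ∈ Ideal.span {x} ∧ b + c * y ∈ Ideal.span {x})
    (hreg : ∀ c : R, c * y ∈ Ideal.span {x} → c ∈ Ideal.span {x})
    (hsq : y ∉ Ideal.span {y, z} * Ideal.span {y, z}) :
    InfinitelyManyExtNeZero R x := by
  have hxy : x * y = 0 := by rw [mul_comm]; exact (hann y).2 (mem_span_pair_left y z)
  have hxz : x * z = 0 := by rw [mul_comm]; exact (hann z).2 (mem_span_pair_right y z)
  have hK := koszulComplex_shortExact hxy hxz hsyz hreg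
  have hA := annihilatorComplex_shortExact hann
  have hI := idealQuotientComplex_shortExact (Ideal.span {y, z})
  have hthree : Nontrivial
      (Ext.{u} (ModuleCat.of R (R ⧸ Ideal.span {x})) (ModuleCat.of R R) 3) := by
    refine nontrivial_ext_succ_of_projective hA two_ne_zero ?_
    refine nontrivial_ext_succ_of_projective hI one_ne_zero ?_
    refine nontrivial_ext_one_of_not_factors hK (ModuleCat.ofHom
      ((Ideal.span {y, z}).subtype ∘ₗ
        quotientSpanToIdeal y (mem_span_pair_left y z) hxy)) fun t ht => hsq ?_
    obtain ⟨T, hT⟩ : ∃ T : (R ⧸ Ideal.span {x}) × (R ⧸ Ideal.span {x}) →ₗ[R] R,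
        T (z • (1, 0) + (-y) • (0, 1)) = y :=
      ⟨t.hom, (congrArg (fun f => f.hom (Ideal.Quotient.mk _ 1)) ht).trans (one_smul R y)⟩
    -- Since `x` kills the source of `T`, the values of `T` lie in the annihilator of `x`; hence `y
    -- = T (z, -y)` would lie in `(y, z)²`.
    have hmem (q : (R ⧸ Ideal.span {x}) × (R ⧸ Ideal.span {x})) :
        T q ∈ Ideal.span {y, z} := by
      have hx (r : R ⧸ Ideal.span {x}) : x • r = 0 := by
        rw [Algebra.smul_def, Ideal.Quotient.algebraMap_eq, Ideal.Quotient.eq_zero_iff_mem.2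
          (Ideal.mem_span_singleton_self x), zero_mul]
      rw [← hann, mul_comm, ← smul_eq_mul, ← map_smul, Prod.smul_def, hx, hx, Prod.mk_zero_zero,
        map_zero]
    rw [map_add, map_smul, map_smul, smul_eq_mul, smul_eq_mul] at hT
    have hy := add_mem (Ideal.mul_mem_mul (mem_span_pair_right y z) (hmem (1, 0)))
      (Ideal.mul_mem_mul (neg_mem (mem_span_pair_left y z)) (hmem (0, 1)))
    rwa [hT] at hy
  have hstep (i : ℕ) (h : Nontrivial
      (Ext.{u} (ModuleCat.of R (R ⧸ Ideal.span {x})) (ModuleCat.of R R) (i + 2))) :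
      Nontrivial
        (Ext.{u} (ModuleCat.of R (R ⧸ Ideal.span {x})) (ModuleCat.of R R) (i + 5)) := by
    -- This Ext group is a quotient of `Ext^(i+1)(R ⧸ (y, z), R)`, which `(y, z)` kills.
    have hsmul (a : R) (ha : a ∈ Ideal.span {y, z})
        (e : Ext.{u} (ModuleCat.of R (R ⧸ Ideal.span {x})) (ModuleCat.of R R) (i + 2)) :
        a • e = 0 := by
      obtain ⟨e', rfl⟩ := precomp_extClass_surjective_of_projective_X₂ _ hA (i + 1) e
      have h0 : a • e' = 0 := smul_ext_quotient_eq_zero ha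
        (e' : Ext.{u} (ModuleCat.of R (R ⧸ Ideal.span {y, z})) _ _)
      change a • hA.extClass.comp e' (add_comm 1 (i + 1)) = 0
      rw [← Ext.comp_smul, h0, Ext.comp_zero]
    have hpre (w : Ext.{u} (ModuleCat.of R ((R ⧸ Ideal.span {x}) × (R ⧸ Ideal.span {x})))
        (ModuleCat.of R R) (i + 2)) :
        (Ext.mk₀ (z • ModuleCat.ofHom (LinearMap.inl R (R ⧸ Ideal.span {x}) (R ⧸ Ideal.span {x})) +
          (-y) • ModuleCat.ofHom (LinearMap.inr R (R ⧸ Ideal.span {x}) (R ⧸ Ideal.span {x})))).comp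
          w (zero_add _) = 0 := by
      rw [Ext.mk₀_add, Ext.add_comp, Ext.mk₀_smul, Ext.mk₀_smul, Ext.smul_comp, Ext.smul_comp,
        hsmul z (mem_span_pair_right y z), hsmul (-y) (neg_mem (mem_span_pair_left y z)), add_zero]
    refine nontrivial_ext_succ_of_projective hA (i + 3).succ_ne_zero ?_
    refine nontrivial_ext_succ_of_projective hI (i + 2).succ_ne_zero ?_
    obtain ⟨e, he⟩ :=
      exists_ne (0 : Ext.{u} (ModuleCat.of R (R ⧸ Ideal.span {x})) (ModuleCat.of R R) (i + 2))
    -- The kernel of the connecting map is the image of precomposition with `(z, -y)`, which is zero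
    -- by `hpre`.
    refine ⟨hK.extClass.comp e (by lia), 0, fun h0 => he ?_⟩
    obtain ⟨x₂, rfl⟩ := Ext.contravariant_sequence_exact₁ hK _ e _ h0
    exact hpre x₂
  have hall (n : ℕ) : Nontrivial
      (Ext.{u} (ModuleCat.of R (R ⧸ Ideal.span {x})) (ModuleCat.of R R) (3 * n + 3)) := by
    induction n with
    | zero => exact hthree
    | succ n ih => exact hstep (3 * n + 1) ih
  exact Set.infinite_of_forall_exists_gt fun n => ⟨3 * n + 3, hall n, by lia⟩

end Koszul

/-! ### The three families of rings -/

section Rings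

variable {k : Type u} [Field k]

/-- The endomorphism of the polynomial ring that sends the variables in `s` to `0`. -/
noncomputable def killVars {σ : Type*} (s : Set σ) [DecidablePred (· ∈ s)] :
    MvPolynomial σ k →ₐ[k] MvPolynomial σ k :=
  aeval (fun i => if i ∈ s then 0 else X i)

theorem killVars_X {σ : Type*} (s : Set σ) [DecidablePred (· ∈ s)] (i : σ) :
    killVars s (X i : MvPolynomial σ k) = if i ∈ s then 0 else X i :=
  aeval_X _ i

theorem sub_killVars_mem_span {σ : Type*} (s : Set σ) [DecidablePred (· ∈ s)]
    (p : MvPolynomial σ k) :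
    p - killVars s p ∈
      Ideal.span (X '' s : Set (MvPolynomial σ k)) := by
  rw [← Ideal.Quotient.eq]
  have h : Ideal.Quotient.mkₐ k (Ideal.span (X '' s : Set (MvPolynomial σ k))) =
      (Ideal.Quotient.mkₐ k _).comp (killVars s) := by
    ext i
    by_cases hi : i ∈ s
    · have h0 := Ideal.Quotient.eq_zero_iff_mem.2
        (Ideal.subset_span (α := MvPolynomial σ k) (Set.mem_image_of_mem X hi))
      simpa [killVars_X, hi] using! h0
    · simp [killVars_X, hi]
  exact DFunLike.congr_fun h p

/-- The homomorphism to the dual numbers that sends `X i` to `ε` and the other variables to `0`. -/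
noncomputable def toDualNumber (k : Type u) [Field k] {n : ℕ} (i : Fin n) :
    MvPolynomial (Fin n) k →ₐ[k] DualNumber k :=
  aeval (fun j => if j = i then DualNumber.eps else 0)

theorem fst_toDualNumber {n : ℕ} (i : Fin n) (p : MvPolynomial (Fin n) k) :
    (toDualNumber k i p).fst = constantCoeff p := by
  have h : (TrivSqZeroExt.fstHom k k k).comp (toDualNumber k i) =
      MvPolynomial.aeval (fun _ => (0 : k)) := by
    ext j
    by_cases hj : j = i <;> simp [toDualNumber, hj]
  have := DFunLike.congr_fun h p
  rw [MvPolynomial.aeval_zero'] at this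
  simpa using this

/-- The maps to dual numbers read off the constant term and the coefficient of `X a` or `X b`. The
retraction `m → R ⧸ m` is the coefficient of `X a`. If `r` fixes `X a`, its constant term is 1, so
it cannot kill `X b`. -/
theorem infinitelyManyExtNeZero_of_socle {n : ℕ} {I : Ideal (MvPolynomial (Fin n) k)}
    {a b : Fin n} (hab : a ≠ b) (hI : ∀ i, X a * X i ∈ I)
    (ha : ∀ p ∈ I, toDualNumber k a p = 0) (hb : ∀ p ∈ I, toDualNumber k b p = 0) :
    InfinitelyManyExtNeZero (MvPolynomial (Fin n) k ⧸ I) (Ideal.Quotient.mk I (X a)) := by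
  let R := MvPolynomial (Fin n) k ⧸ I
  let φ : R →ₐ[k] DualNumber k := Ideal.Quotient.liftₐ I (toDualNumber k a) ha
  let ψ : R →ₐ[k] DualNumber k := Ideal.Quotient.liftₐ I (toDualNumber k b) hb
  have hφa : φ (Ideal.Quotient.mk I (X a)) = DualNumber.eps := by
    change toDualNumber k a (X a) = _; simp [toDualNumber]
  have hφb : φ (Ideal.Quotient.mk I (X b)) = 0 := by
    change toDualNumber k a (X b) = _; simp [toDualNumber, hab.symm]
  have hψb : ψ (Ideal.Quotient.mk I (X b)) = DualNumber.eps := by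
    change toDualNumber k b (X b) = _; simp [toDualNumber]
  have hfst (r : R) : (ψ r).fst = (φ r).fst := by
    obtain ⟨p, rfl⟩ := Ideal.Quotient.mk_surjective r
    exact (fst_toDualNumber b p).trans (fst_toDualNumber a p).symm
  let m : Ideal R := RingHom.ker ((TrivSqZeroExt.fstHom k k k).comp φ)
  have hm (r : R) : r ∈ m ↔ (φ r).fst = 0 := Iff.rfl
  have hmul (r : R) (hr : r ∈ m) : r * Ideal.Quotient.mk I (X a) = 0 := by
    obtain ⟨p, rfl⟩ := Ideal.Quotient.mk_surjective r
    have hp : constantCoeff p = 0 := (fst_toDualNumber a p).symm.trans hr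
    rw [← map_mul, Ideal.Quotient.eq_zero_iff_mem]
    have hp' : p ∈ Ideal.span (Set.range X) := by
      rw [← Set.image_univ, mem_ideal_span_X_image]
      intro d hd
      by_contra! hd0
      have : d = 0 := Finsupp.ext fun i => hd0 i trivial
      rw [mem_support_iff, this] at hd
      exact hd hp
    clear hr hp
    induction hp' using Submodule.span_induction with
    | mem q hq =>
      obtain ⟨i, rfl⟩ := hq
      rw [mul_comm]
      exact hI i
    | zero => simp
    | add q r _ _ hq hr => rw [add_mul]; exact add_mem hq hr
    | smul c q _ hq => rw [smul_eq_mul, mul_assoc]; exact I.mul_mem_left c hq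
  have hann (r : R) : r * Ideal.Quotient.mk I (X a) = 0 ↔ r ∈ m := by
    refine ⟨fun h => ?_, hmul r⟩
    have := congrArg (fun t => (φ t).snd) h
    simpa [hφa] using! this
  -- `R` acts on `R ⧸ m` through constant terms.
  have hres (r : R) (c : k) :
      algebraMap k (R ⧸ m) ((φ r).fst * c) = r • algebraMap k (R ⧸ m) c := by
    have h : algebraMap k (R ⧸ m) (φ r).fst = Ideal.Quotient.mk m r := by
      refine (Ideal.Quotient.eq (x := algebraMap k R (φ r).fst)).2 ?_
      rw [hm, map_sub, AlgHom.commutes]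
      simp [TrivSqZeroExt.algebraMap_eq_inl]
    rw [map_mul, h]
    exact (Algebra.smul_def r _).symm
  let p : m →ₗ[R] R ⧸ m :=
    { toFun := fun j => algebraMap k (R ⧸ m) (φ j).snd
      map_add' := fun i j => by simp
      map_smul' := fun r j => by
        rw [RingHom.id_apply, ← hres]
        congr 1
        have hj : (φ j).fst = 0 := j.2
        simp [hj] }
  have hXb : Ideal.Quotient.mk I (X b) ∈ m := by rw [hm, hφb]; rfl
  have hXa : Ideal.Quotient.mk I (X a) ∈ m := by rw [hm, hφa]; simp
  refine infinitelyManyExtNeZero_of_retraction hann hXa p ?_ ⟨_, hXb⟩ ?_ ?_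
  · change algebraMap k (R ⧸ m) (φ _).snd = 1
    rw [hφa]; simp
  · change algebraMap k (R ⧸ m) (φ _).snd = 0
    rw [hφb]; simp
  · intro r h1 h2
    have e1 := congrArg (fun t => (φ t).snd) h1
    have e2 := congrArg (fun t => (ψ t).snd) h2
    simp only [map_mul, hφa, hψb] at e1 e2
    simp [hfst] at e1 e2
    rw [e1] at e2
    exact one_ne_zero e2

theorem infinitelyManyExtNeZero_allQuadraticRing :
    InfinitelyManyExtNeZero (AllQuadraticRing k) (Ideal.Quotient.mk _ (X 0)) := by
  have key (i : Fin 2) (p) (hp : p ∈ (Ideal.span {X 0 ^ 2, X 0 * X 1, X 1 ^ 2} :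
      Ideal (MvPolynomial (Fin 2) k))) : toDualNumber k i p = 0 := by
    have : Ideal.span {X 0 ^ 2, X 0 * X 1, X 1 ^ 2} ≤ RingHom.ker (toDualNumber k i) := by
      rw [Ideal.span_le]
      rintro q (rfl | rfl | rfl) <;> fin_cases i <;> simp [toDualNumber, pow_two]
    exact this hp
  refine infinitelyManyExtNeZero_of_socle (b := 1) (by simp) (fun i => ?_) (key 0) (key 1)
  fin_cases i
  · exact Ideal.subset_span (by simp [pow_two])
  · exact Ideal.subset_span (by simp)

theorem infinitelyManyExtNeZero_mixedRing (n : ℕ) [NeZero n] (hn : 2 ≤ n) :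
    InfinitelyManyExtNeZero (MixedRing k n) (Ideal.Quotient.mk _ (X 0)) := by
  have key (i : Fin n) (p) (hp : p ∈ mixedIdeal k n) : toDualNumber k i p = 0 := by
    have : mixedIdeal k n ≤ RingHom.ker (toDualNumber k i) := by
      rw [mixedIdeal, Ideal.span_le]
      rintro q (rfl | ⟨a, b, hab, rfl⟩)
      · by_cases h : 0 = i <;> simp [toDualNumber, pow_two, h]
      · by_cases h : a = i
        · have h' : b ≠ i := fun hb => hab (h.trans hb.symm)
          simp [toDualNumber, h']
        · simp [toDualNumber, h]
    exact this hp
  have h01 : (0 : Fin n) ≠ ⟨1, hn⟩ := fun h => by simpa using congrArg Fin.val h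
  refine infinitelyManyExtNeZero_of_socle h01 (fun i => Ideal.subset_span ?_) (key _) (key _)
  by_cases hi : 0 = i
  · left; simp [← hi, pow_two]
  · exact Or.inr ⟨0, i, hi, rfl⟩

theorem infinitelyManyExtNeZero_linePlaneRing :
    InfinitelyManyExtNeZero (LinePlaneRing k) (Ideal.Quotient.mk _ (X 0)) := by
  let I : Ideal (MvPolynomial (Fin 3) k) := Ideal.span {X 0 * X 1, X 0 * X 2}
  let mk : MvPolynomial (Fin 3) k →+* MvPolynomial (Fin 3) k ⧸ I := Ideal.Quotient.mk I
  have hker (s : Set (Fin 3)) [DecidablePred (· ∈ s)] (p : MvPolynomial (Fin 3) k)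
      (h : killVars s p = 0) :
      p ∈ Ideal.span (X '' s) := by
    have := sub_killVars_mem_span s p
    rwa [h, sub_zero] at this
  have hmem (J : Ideal (MvPolynomial (Fin 3) k)) (h1 : X 0 * X 1 ∈ J) (h2 : X 0 * X 2 ∈ J)
      (p : MvPolynomial (Fin 3) k) (hp : mk p = 0) :
      p ∈ J := by
    have : I ≤ J := Ideal.span_le.2 (by rintro q (rfl | rfl); exacts [h1, h2])
    exact this (Ideal.Quotient.eq_zero_iff_mem.1 hp)
  have hfx (p : MvPolynomial (Fin 3) k) (hp : mk p = 0) : killVars {0} p = 0 :=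
    hmem (RingHom.ker (killVars {0})) (by simp [killVars_X]) (by simp [killVars_X]) p hp
  have hfyz (p : MvPolynomial (Fin 3) k) (hp : mk p = 0) : killVars {1, 2} p = 0 :=
    hmem (RingHom.ker (killVars {1, 2})) (by simp [killVars_X]) (by simp [killVars_X]) p hp
  have hx (p : MvPolynomial (Fin 3) k) (h : killVars {0} p = 0) : mk p ∈ Ideal.span {mk (X 0)} := by
    have := Ideal.mem_map_of_mem mk (hker {0} p h)
    rwa [Ideal.map_span, Set.image_singleton, Set.image_singleton] at this
  have hf0 (p : MvPolynomial (Fin 3) k) (h : mk p ∈ Ideal.span {mk (X 0)}) : killVars {0} p = 0 := by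
    obtain ⟨c, hc⟩ := Ideal.mem_span_singleton'.1 h
    obtain ⟨c, rfl⟩ := Ideal.Quotient.mk_surjective c
    have := hfx (p - c * X 0) (by rw [map_sub, map_mul, sub_eq_zero]; exact hc.symm)
    simpa [killVars_X] using this
  have h01 : mk (X 1) * mk (X 0) = 0 := by
    rw [mul_comm, ← map_mul]
    exact Ideal.Quotient.eq_zero_iff_mem.2 (Ideal.subset_span (by simp))
  have h02 : mk (X 2) * mk (X 0) = 0 := by
    rw [mul_comm, ← map_mul]
    exact Ideal.Quotient.eq_zero_iff_mem.2 (Ideal.subset_span (by simp))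
  refine infinitelyManyExtNeZero_of_koszul (y := mk (X 1)) (z := mk (X 2)) ?_ ?_ ?_ ?_
  · intro r
    obtain ⟨p, rfl⟩ := Ideal.Quotient.mk_surjective r
    constructor
    · intro h
      have h2 := hfyz (p * X 0) ((map_mul mk _ _).trans h)
      have h3 : killVars {1, 2} p = 0 := by simpa [killVars_X] using h2
      have := Ideal.mem_map_of_mem mk (hker {1, 2} p h3)
      rwa [Ideal.map_span, Set.image_pair, Set.image_pair] at this
    · intro h
      obtain ⟨a, b, hab⟩ := Ideal.mem_span_pair.1 h
      rw [← hab]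
      change (a * mk (X 1) + b * mk (X 2)) * mk (X 0) = 0
      rw [add_mul, mul_assoc, mul_assoc, h01, h02, mul_zero, mul_zero, add_zero]
  · intro a b hab
    obtain ⟨a, rfl⟩ := Ideal.Quotient.mk_surjective a
    obtain ⟨b, rfl⟩ := Ideal.Quotient.mk_surjective b
    have h : killVars {0} a * X 1 + killVars {0} b * X 2 = 0 := by
      have := hfx (a * X 1 + b * X 2) (by rw [map_add, map_mul, map_mul]; exact hab)
      simpa [killVars_X] using this
    have hdvd : X 2 ∣ killVars {0} a * X 1 := ⟨-killVars {0} b, by linear_combination h⟩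
    rcases (X_prime (R := k) (i := (2 : Fin 3))).dvd_or_dvd hdvd with ⟨c, hc⟩ | h21
    · have hb : killVars {0} b = -(X 1 * c) := by
        refine mul_right_cancel₀ (X_ne_zero (R := k) (2 : Fin 3)) ?_
        linear_combination h - X 1 * hc
      -- Applying `killVars {0}` again to `hc` and `hb` reduces `c` too, so `c` itself need not be
      -- free of `X 0`.
      have hid (p : MvPolynomial (Fin 3) k) : killVars {0} (killVars {0} p) = killVars {0} p := by
        have : (killVars (k := k) {(0 : Fin 3)}).comp (killVars {0}) = killVars {0} := by
          ext i : 1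
          by_cases hi : i = 0 <;> simp [killVars_X, hi]
        exact DFunLike.congr_fun this p
      refine ⟨mk c, ?_, ?_⟩
      · refine (map_mul mk c (X 2) ▸ map_sub mk a (c * X 2)) ▸ hx _ ?_
        have := congrArg (killVars {0}) hc
        rw [hid] at this
        rw [map_sub, this]
        simp [killVars_X, mul_comm]
      · refine (map_mul mk c (X 1) ▸ map_add mk b (c * X 1)) ▸ hx _ ?_
        have := congrArg (killVars {0}) hb
        rw [hid] at this
        rw [map_add, this]
        simp [killVars_X, mul_comm]
    · simp [X_dvd_X] at h21
  · intro c hc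
    obtain ⟨c, rfl⟩ := Ideal.Quotient.mk_surjective c
    refine hx c ?_
    have := hf0 (c * X 1) ((map_mul mk _ _) ▸ hc)
    simpa [killVars_X] using this
  · intro h
    -- Sending `y` to `ε` and the other variables to `0` kills `(y, z)²` but not `y`.
    let θ : MvPolynomial (Fin 3) k ⧸ I →+* DualNumber k := Ideal.Quotient.lift I (toDualNumber k (1 : Fin 3)).toRingHom
      (fun p hp => hmem (RingHom.ker (toDualNumber k (1 : Fin 3))) (by simp [toDualNumber])
        (by simp [toDualNumber]) p (Ideal.Quotient.eq_zero_iff_mem.2 hp))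
    have h1 : θ (mk (X 1)) = DualNumber.eps := by
      change toDualNumber k 1 (X 1) = _; simp [toDualNumber]
    have h2 : θ (mk (X 2)) = 0 := by
      change toDualNumber k 1 (X 2) = _; simp [toDualNumber]
    have hle : Ideal.span {mk (X 1), mk (X 2)} * Ideal.span {mk (X 1), mk (X 2)} ≤
        RingHom.ker θ := by
      rw [Ideal.span_pair_mul_span_pair, Ideal.span_le]
      rintro q (rfl | rfl | rfl | rfl) <;> simp [h1, h2]
    have := hle h
    rw [RingHom.mem_ker, h1] at this
    simpa using congrArg TrivSqZeroExt.snd this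

end Rings

theorem theorem6p1 (k : Type u) [Field k] :
    (selfInjectiveDimension (LinePlaneRing k) = ⊤ ∧
      InfinitelyManyExtNeZero (LinePlaneRing k) (Ideal.Quotient.mk _ (X 0))) ∧
    (selfInjectiveDimension (AllQuadraticRing k) = ⊤ ∧
      InfinitelyManyExtNeZero (AllQuadraticRing k) (Ideal.Quotient.mk _ (X 0))) ∧
    (∀ (n : ℕ) [NeZero n], 2 ≤ n →
      selfInjectiveDimension (MixedRing k n) = ⊤ ∧
      InfinitelyManyExtNeZero (MixedRing k n) (Ideal.Quotient.mk _ (X 0))) :=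
  ⟨⟨selfInjectiveDimension_eq_top infinitelyManyExtNeZero_linePlaneRing,
      infinitelyManyExtNeZero_linePlaneRing⟩,
    ⟨selfInjectiveDimension_eq_top infinitelyManyExtNeZero_allQuadraticRing,
      infinitelyManyExtNeZero_allQuadraticRing⟩,
    fun n _ hn => ⟨selfInjectiveDimension_eq_top (infinitelyManyExtNeZero_mixedRing n hn),
      infinitelyManyExtNeZero_mixedRing n hn⟩⟩
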